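/- Let $\alpha$ be a finite measure on $(\mathbb R,\mathcal B(\mathbb R))$ with total mass $a=\alpha(\mathbb R)>0$ and $\int_{\mathbb R}\log(1+|x|)\,\alpha(dx)<+\infty$, and let $A(x)=\alpha((-\infty,x])$. Let $\tilde\gamma$ be a random finite measure on $\mathbb R$ whose law is the functional gamma distribution $\mathcal G_\alpha$ with parameter $\alpha$: for every finite measurable partition $\{B_1,\dots,B_k\}$ of $\mathbb R$ the random variables $\tilde\gamma(B_1),\dots,\tilde\gamma(B_k)$ are independent and gamma distributed with $E\,\tilde\gamma(B_j)=\mathrm{Var}\,\tilde\gamma(B_j)=\alpha(B_j)$. Put $$g(x)=-\frac{|x|}{1+x^2}\Big[\mathbb I_{[0,+\infty)}(x)\int_{(0,+\infty)}e^{-yx}\,dA(y^{-1})+\mathbb I_{(-\infty,0)}(x)\int_{(-\infty,0)}e^{-yx}\,dA(y^{-1})\Big],\qquad x\in\mathbb R,$$ where $-dA(y^{-1})$ is the Lebesgue–Stieltjes measure of the function $y\mapsto -A(y^{-1})$, nondecreasing on each of the two half-lines. Then $\int|x|\,\tilde\gamma(dx)<+\infty$ almost surely, so that $\tilde\gamma(I):=\int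 x\,\tilde\gamma(dx)$ is a well-defined random variable, and its characteristic function is infinitely divisible. Moreover $g\ge 0$, the functions $g$ and $x^{-1}g(x)$ are integrable on $\mathbb R$ and $\mathbb R\setminus\{0\}$ respectively, and the characteristic function has the Lévy–Khintchine representation $$\mathcal G_\alpha\big(e^{it\tilde\gamma(I)}\big)=\exp\Big\{i\gamma t+\int_{\mathbb R\setminus\{0\}}\Big(e^{itu}-1-\frac{itu}{1+u^2}\Big)\frac{1+u^2}{u^2}\,dG(u)\Big\},\qquad t\in\mathbb R,$$ determined by the pair $(\gamma,G)$ with $$\gamma=\int_{\mathbb R\setminus\{0\}}x^{-1}g(x)\,dx,\qquad G(x)=\int_{-\infty}^x g(u)\,du,\quad dG(x)=g(x)\,dx,$$ where $G$ is nondecreasing and right-continuous with $G(-\infty)=0$ and $G(+\infty)<+\infty$. In particular, $\mathcal G_\alpha(e^{it\tilde\gamma(I)})=1$ for every $t\in\mathbb R$ if and only if $\alpha=a\,\delta_0$, i.e. $\alpha$ is concentrated at $0$. -/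

import Mathlib

open MeasureTheory ProbabilityTheory Set Filter Topology

noncomputable section

/-- The gamma distribution on the line whose mean and variance both equal `b`, for `b ≥ 0`: shape `b`
and rate `1` if `b ≠ 0`, and the unit mass at `0` if `b = 0`. -/
def gammaLaw (b : ℝ) : Measure ℝ :=
  if b = 0 then Measure.dirac 0 else gammaMeasure b 1

/-- `Q` is the functional gamma distribution with parameter `α`: a probability measure on the space
of finite measures on the line such that, under `Q`, the masses of the cells of every finite
measurable partition of the line are independent and gamma distributed, the mass of a cell `B`
having mean and variance `α B`. The sigma-algebra on `FiniteMeasure ℝ` is the one generated by the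
evaluations at measurable sets, which is also the Borel sigma-algebra of weak convergence. -/
structure IsFunctionalGamma (α : Measure ℝ) (Q : Measure (FiniteMeasure ℝ)) : Prop where
  isProbabilityMeasure : IsProbabilityMeasure Q
  hasLaw : ∀ (k : ℕ) (B : Fin k → Set ℝ), (∀ i, MeasurableSet (B i)) →
    Pairwise (fun i j => Disjoint (B i) (B j)) → (⋃ i, B i) = univ →
    ∀ i, HasLaw (fun m : FiniteMeasure ℝ => (m (B i) : ℝ)) (gammaLaw (α.real (B i))) Q
  indep : ∀ (k : ℕ) (B : Fin k → Set ℝ), (∀ i, MeasurableSet (B i)) →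
    Pairwise (fun i j => Disjoint (B i) (B j)) → (⋃ i, B i) = univ →
    iIndepFun (fun i (m : FiniteMeasure ℝ) => (m (B i) : ℝ)) Q

/-- The mean `∫ x m(dx)` of a finite measure `m` on the line (meaningful if `x` is integrable). -/
def measureMean (m : FiniteMeasure ℝ) : ℝ :=
  ∫ x, x ∂(m : Measure ℝ)

/-- `φ` is an infinitely divisible characteristic function: for every `n ≥ 1` it is the `n`-th power
of the characteristic function of a probability measure (so, with `n = 1`, `φ` is itself one). -/
def IsInfinitelyDivisibleCharFun (φ : ℝ → ℂ) : Prop :=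
  ∀ n : ℕ, 1 ≤ n → ∃ ν : Measure ℝ, IsProbabilityMeasure ν ∧ ∀ t, φ t = charFun ν t ^ n

/-- `φ` has the Lévy–Khintchine representation determined by the pair `(c, G)`, where `c` is a real
number and `G` is a nondecreasing right-continuous function with `G(-∞) = 0` and `G(+∞) < +∞`. -/
structure IsLevyKhintchinePair (φ : ℝ → ℂ) (c : ℝ) (G : StieltjesFunction ℝ) : Prop where
  tendsto_atBot : Tendsto G atBot (𝓝 0)
  tendsto_atTop : ∃ l : ℝ, Tendsto G atTop (𝓝 l)
  representation : ∀ t : ℝ, φ t = Complex.exp (Complex.I * c * t +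
    ∫ u in ({0}ᶜ : Set ℝ), (Complex.exp (Complex.I * t * u) - 1 - Complex.I * t * u / (1 + u ^ 2)) *
      ((1 + u ^ 2) / u ^ 2) ∂G.measure)

/-- The distribution function `A` of `α`. -/
def distFun (α : Measure ℝ) (x : ℝ) : ℝ := α.real (Iic x)

/-- The measure `-dA(y⁻¹)` on the punctured line, that is, the image under `x ↦ x⁻¹` of the
restriction of `α` to the punctured line. -/
def inverseMeasure (α : Measure ℝ) : Measure ℝ :=
  (α.restrict {0}ᶜ).map (fun x => x⁻¹)

/-- On either half-line `inverseMeasure α` is the Lebesgue–Stieltjes measure of the nondecreasing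
left-continuous function `y ↦ -A(y⁻¹)`. -/
theorem inverseMeasure_Ico (α : Measure ℝ) [IsFiniteMeasure α] {y z : ℝ} (hyz : y < z)
    (h0 : 0 < y ∨ z < 0) :
    inverseMeasure α (Ico y z) = ENNReal.ofReal (distFun α y⁻¹ - distFun α z⁻¹) := by
  have hinv : z⁻¹ < y⁻¹ := by
    rcases h0 with h | h
    · exact inv_strictAnti₀ h hyz
    · exact (inv_lt_inv_of_neg h (hyz.trans h)).2 hyz
  have hset : (fun x : ℝ => x⁻¹) ⁻¹' Ico y z ∩ {0}ᶜ = Iic y⁻¹ \ Iic z⁻¹ := by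
    ext x
    simp only [mem_inter_iff, mem_preimage, mem_Ico, mem_compl_iff, mem_singleton_iff, Set.mem_sdiff,
      mem_Iic, not_le]
    rcases h0 with h | h
    · have hz : 0 < z := h.trans hyz
      constructor
      · rintro ⟨⟨h1, h2⟩, -⟩
        have hx : 0 < x := inv_pos.1 (h.trans_le h1)
        exact ⟨(le_inv_comm₀ h hx).1 h1, (inv_lt_comm₀ hx hz).1 h2⟩
      · rintro ⟨h1, h2⟩
        have hx : 0 < x := (inv_pos.2 hz).trans h2
        exact ⟨⟨(le_inv_comm₀ h hx).2 h1, (inv_lt_comm₀ hx hz).2 h2⟩, hx.ne'⟩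
    · have hy : y < 0 := hyz.trans h
      constructor
      · rintro ⟨⟨h1, h2⟩, -⟩
        have hx : x < 0 := inv_lt_zero.1 (h2.trans h)
        exact ⟨(le_inv_of_neg hy hx).1 h1, (inv_lt_of_neg hx h).1 h2⟩
      · rintro ⟨h1, h2⟩
        have hx : x < 0 := h1.trans_lt (inv_lt_zero.2 hy)
        exact ⟨⟨(le_inv_of_neg hy hx).2 h1, (inv_lt_of_neg hx h).2 h2⟩, hx.ne⟩
  have hm : MeasurableSet ((fun x : ℝ => x⁻¹) ⁻¹' Ico y z) := measurable_inv measurableSet_Ico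
  rw [inverseMeasure, Measure.map_apply measurable_inv measurableSet_Ico, Measure.restrict_apply hm,
    hset, distFun, distFun, ← measureReal_sdiff (Iic_subset_Iic.2 hinv.le) measurableSet_Iic,
    ofReal_measureReal]

/-- The function `g(x) = -|x|/(1+x²) [1_{x ≥ 0} ∫_{(0,∞)} e^{-yx} dA(y⁻¹) +
1_{x < 0} ∫_{(-∞,0)} e^{-yx} dA(y⁻¹)]`; the leading minus sign is absorbed by integrating with
respect to `-dA(y⁻¹)`. -/
def levyG (α : Measure ℝ) (x : ℝ) : ℝ :=
  |x| / (1 + x ^ 2) *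
    ((Ici (0 : ℝ)).indicator (fun u => ∫ y in Ioi 0, Real.exp (-(y * u)) ∂inverseMeasure α) x +
      (Iio (0 : ℝ)).indicator (fun u => ∫ y in Iio 0, Real.exp (-(y * u)) ∂inverseMeasure α) x)

end

/-! ### Exponential moments of the gamma distribution -/

/-! Everything follows from one formula: the mean has characteristic function `exp (-∫ log (1 - itx)
α(dx))`. For a simple function `h`, `∫ h dm` is a linear combination of independent gamma masses, so
its exponential moments are explicit (`IsFunctionalGamma.integral_cexp_simpleFunc`). Simple
functions `h n → id` with `|h n x| ≤ 2|x|` carry the formula to the identity, with a majorant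
supplied by the log moment; a Laplace transform argument first shows that `x` is almost surely
integrable.

The exponent is linear in `α`, so an `n`-th root of the characteristic function has the same form
with parameter `α / n`. That it is a characteristic function comes from finite products of gamma
laws and tightness.

Frullani's integral `log (1 + z) = ∫ (1 - exp (-zv)) exp (-v) / v dv`, the substitution `u = xv` and
Fubini turn the exponent into `∫ (exp (itu) - 1) k(u) du` with `k = levyDensity α`, and `g = k u² /
(1 + u²)` (`levyG_eq`). Since `k u / (1 + u²) = g / u` is integrable, the centering term of the
Lévy–Khintchine kernel integrates to `-itγ`, which the drift cancels.

In the degenerate case the modulus at `t = 1` forces `∫ log |1 - ix| α(dx) = 0`, so `α` lives at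
`0`. -/

theorem integral_gammaMeasure {E : Type*} [NormedAddCommGroup E] [NormedSpace ℝ E] {b : ℝ}
    (hb : 0 < b) (f : ℝ → E) :
    ∫ x, f x ∂gammaMeasure b 1 = ∫ x in Ioi 0, gammaPDFReal b 1 x • f x := by
  have hm : Measurable (gammaPDF b 1) := (measurable_gammaPDFReal b 1).ennreal_ofReal
  rw [gammaMeasure, integral_withDensity_eq_integral_toReal_smul hm (by simp [gammaPDF]),
    ← integral_Ici_eq_integral_Ioi, ← integral_indicator measurableSet_Ici]
  refine integral_congr_ae (Eventually.of_forall fun x => ?_)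
  by_cases hx : 0 ≤ x
  · simp [gammaPDF, hx, gammaPDFReal_nonneg hb one_pos x]
  · simp [hx, gammaPDF_of_neg (not_le.1 hx)]

theorem mgf_gammaMeasure {b z : ℝ} (hb : 0 < b) (hz : z < 1) :
    mgf id (gammaMeasure b 1) z = (1 - z) ^ (-b) := by
  rw [mgf, integral_gammaMeasure hb]
  have h := Real.integral_rpow_mul_exp_neg_mul_Ioi hb (sub_pos.2 hz)
  have hG := Real.Gamma_pos_of_pos hb
  calc ∫ x in Ioi 0, gammaPDFReal b 1 x • Real.exp (z * id x)
      = ∫ x in Ioi 0, (Real.Gamma b)⁻¹ * (x ^ (b - 1) * Real.exp (-((1 - z) * x))) := by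
        refine setIntegral_congr_fun measurableSet_Ioi fun x hx => ?_
        have hx' : 0 ≤ x := le_of_lt hx
        simp only [gammaPDFReal, hx', if_true, smul_eq_mul, Real.one_rpow, id]
        rw [show -((1 - z) * x) = -(1 * x) + z * x by ring, Real.exp_add]
        ring
    _ = (1 - z) ^ (-b) := by
        rw [integral_const_mul, h, one_div, Real.inv_rpow (sub_pos.2 hz).le,
          Real.rpow_neg (sub_pos.2 hz).le]
        field_simp

/-- A Bochner integral that diverges has value `0`, whereas the formula for the mgf is positive; so
the formula itself proves integrability. -/
theorem Iio_one_subset_integrableExpSet_gammaMeasure {b : ℝ} (hb : 0 < b) :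
    Iio 1 ⊆ interior (integrableExpSet id (gammaMeasure b 1)) := by
  refine interior_maximal (fun z hz => ?_) isOpen_Iio
  by_contra h
  have h1 := mgf_gammaMeasure hb hz
  rw [mgf_undef h] at h1
  exact (Real.rpow_pos_of_pos (sub_pos.2 hz) _).ne h1

/-- Identity theorem: both sides are analytic on the connected half-plane `re z < 1` and agree at
its real points, which accumulate at `0`. -/
theorem complexMGF_gammaMeasure {b : ℝ} (hb : 0 < b) {z : ℂ} (hz : z.re < 1) :
    complexMGF id (gammaMeasure b 1) z = Complex.exp (-(b * Complex.log (1 - z))) := by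
  have hsub := Iio_one_subset_integrableExpSet_gammaMeasure hb
  have hopen : IsOpen {z : ℂ | z.re < 1} := isOpen_lt Complex.continuous_re continuous_const
  have h1 : AnalyticOnNhd ℂ (complexMGF id (gammaMeasure b 1)) {z : ℂ | z.re < 1} :=
    fun w hw => analyticAt_complexMGF (hsub hw)
  have h2 : AnalyticOnNhd ℂ (fun z : ℂ => Complex.exp (-(b * Complex.log (1 - z))))
      {z : ℂ | z.re < 1} := by
    refine DifferentiableOn.analyticOnNhd (fun w hw => DifferentiableAt.differentiableWithinAt ?_)
      hopen
    have : 1 - w ∈ Complex.slitPlane := Or.inl (by simpa using hw)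
    fun_prop (disch := assumption)
  have hreal : ∀ x : ℝ, x < 1 → complexMGF id (gammaMeasure b 1) x =
      Complex.exp (-(b * Complex.log (1 - x))) := by
    intro x hx
    rw [complexMGF_ofReal, mgf_gammaMeasure hb hx, Real.rpow_def_of_pos (sub_pos.2 hx)]
    rw [Complex.ofReal_exp]
    congr 1
    push_cast [Complex.ofReal_log (sub_pos.2 hx).le]
    ring
  refine AnalyticOnNhd.eqOn_of_preconnected_of_frequently_eq h1 h2
    (convex_halfSpace_re_lt 1).isPreconnected (z₀ := 0) (by simp) ?_ hz
  have hfr : ∃ᶠ x : ℝ in 𝓝[≠] 0, x < 1 :=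
    (eventually_nhdsWithin_of_eventually_nhds (gt_mem_nhds one_pos)).frequently
  have ht : Tendsto (fun x : ℝ => (x : ℂ)) (𝓝[≠] 0) (𝓝[≠] 0) := by
    refine tendsto_nhdsWithin_iff.2 ⟨?_, ?_⟩
    · exact (Complex.continuous_ofReal.tendsto' 0 0 (by simp)).mono_left nhdsWithin_le_nhds
    · filter_upwards [self_mem_nhdsWithin] with x hx
      simpa using hx
  exact ht.frequently (hfr.mono fun x hx => hreal x hx)

theorem isProbabilityMeasure_gammaLaw {b : ℝ} (hb : 0 ≤ b) :
    IsProbabilityMeasure (gammaLaw b) := by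
  unfold gammaLaw
  split_ifs with h
  · infer_instance
  · exact isProbabilityMeasure_gammaMeasure (lt_of_le_of_ne hb (Ne.symm h)) one_pos

theorem integral_cexp_gammaLaw {b : ℝ} (hb : 0 ≤ b) {z : ℂ} (hz : z.re < 1) :
    ∫ x : ℝ, Complex.exp (z * x) ∂gammaLaw b = Complex.exp (-(b * Complex.log (1 - z))) := by
  unfold gammaLaw
  split_ifs with h
  · simp [h]
  · exact complexMGF_gammaMeasure (lt_of_le_of_ne hb (Ne.symm h)) hz

/-- The exponential moment of a linear combination of independent gamma variables. -/
theorem integral_cexp_sum_of_gammaLaw {Ω ι : Type*} [Fintype ι] [MeasurableSpace Ω]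
    {P : Measure Ω} {X : ι → Ω → ℝ} {b c : ι → ℝ} (hb : ∀ i, 0 ≤ b i)
    (hX : ∀ i, HasLaw (X i) (gammaLaw (b i)) P) (hind : iIndepFun X P) {z : ℂ}
    (hz : ∀ i, (z * c i).re < 1) :
    ∫ ω, Complex.exp (z * ((∑ i, c i * X i ω : ℝ) : ℂ)) ∂P =
      Complex.exp (-∑ i, b i * Complex.log (1 - z * c i)) := by
  have h : ∀ ω, Complex.exp (z * ((∑ i, c i * X i ω : ℝ) : ℂ)) =
      ∏ i, (fun x : ℝ => Complex.exp (z * c i * x)) (X i ω) := by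
    intro ω
    rw [← Complex.exp_sum]
    congr 1
    push_cast
    rw [Finset.mul_sum]
    exact Finset.sum_congr rfl fun i _ => by ring
  simp_rw [h]
  rw [hind.integral_fun_prod_comp (f := fun i (x : ℝ) => Complex.exp (z * c i * x))
    (fun i => (hX i).aemeasurable)
    (fun i => (by fun_prop : Continuous fun x : ℝ => Complex.exp (z * c i * x)).aestronglyMeasurable),
    ← Finset.sum_neg_distrib, Complex.exp_sum]
  refine Finset.prod_congr rfl fun i _ => ?_
  rw [← integral_cexp_gammaLaw (hb i) (hz i), ← (hX i).map_eq, integral_map (hX i).aemeasurable]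
  exact (by fun_prop : Continuous fun x : ℝ => Complex.exp (z * c i * x)).aestronglyMeasurable

theorem sum_range_eq_integral_log {α : Measure ℝ} [IsFiniteMeasure α] (h : SimpleFunc ℝ ℝ)
    (z : ℂ) : ∑ y ∈ h.range, (α.real (h ⁻¹' {y}) : ℂ) * Complex.log (1 - z * y) =
      ∫ x, Complex.log (1 - z * h x) ∂α := by
  have h1 := SimpleFunc.map_integral (μ := α) h (fun y : ℝ => Complex.log (1 - z * y))
    (SimpleFunc.integrable_of_isFiniteMeasure h) (by simp)
  rw [SimpleFunc.integral_eq_integral _ (SimpleFunc.integrable_of_isFiniteMeasure _)] at h1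
  simp only [SimpleFunc.coe_map, Function.comp_def] at h1
  rw [h1]
  simp

/-- The Laplace–Fourier functional of the functional gamma distribution at a simple function. -/
theorem IsFunctionalGamma.integral_cexp_simpleFunc {α : Measure ℝ} [IsFiniteMeasure α]
    {Q : Measure (FiniteMeasure ℝ)} (hQ : IsFunctionalGamma α Q) (h : SimpleFunc ℝ ℝ) {z : ℂ}
    (hz : ∀ x, (z * h x).re < 1) :
    ∫ m : FiniteMeasure ℝ, Complex.exp (z * ((∫ x, h x ∂(m : Measure ℝ) : ℝ) : ℂ)) ∂Q =
      Complex.exp (-∫ x, Complex.log (1 - z * h x) ∂α) := by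
  -- The cells are the fibres of `h`, relabelled by `Fin` to match the partitions in
  -- `IsFunctionalGamma`.
  let e := h.range.equivFin
  let B : Fin h.range.card → Set ℝ := fun i => h ⁻¹' {(e.symm i : ℝ)}
  have hB : ∀ i, MeasurableSet (B i) := fun i => h.measurableSet_fiber _
  have hd : Pairwise fun i j => Disjoint (B i) (B j) := by
    intro i j hij
    refine Disjoint.preimage _ (disjoint_singleton.2 fun hh => hij ?_)
    exact e.symm.injective (Subtype.ext hh)
  have hU : ⋃ i, B i = univ := by
    refine eq_univ_of_forall fun x => mem_iUnion.2 ⟨e ⟨h x, h.mem_range_self x⟩, ?_⟩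
    simp [B]
  have hsum : ∀ m : FiniteMeasure ℝ, ∫ x, h x ∂(m : Measure ℝ) =
      ∑ i, (e.symm i : ℝ) * (m (B i) : ℝ) := by
    intro m
    rw [SimpleFunc.integral_eq_sum _ (SimpleFunc.integrable_of_isFiniteMeasure h),
      ← Finset.sum_coe_sort, ← e.symm.sum_comp]
    refine Finset.sum_congr rfl fun i _ => ?_
    rw [smul_eq_mul, mul_comm]
    rfl
  simp_rw [hsum]
  rw [integral_cexp_sum_of_gammaLaw (fun i => measureReal_nonneg) (hQ.hasLaw _ B hB hd hU)
    (hQ.indep _ B hB hd hU) (c := fun i => (e.symm i : ℝ)), ← sum_range_eq_integral_log,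
    ← Finset.sum_coe_sort h.range, ← e.symm.sum_comp]
  intro i
  obtain ⟨x, hx⟩ := SimpleFunc.mem_range.1 (e.symm i).2
  rw [← hx]
  exact hz x

/-! ### The characteristic function of the mean -/

theorem Real.log_one_add_mul_le {c y : ℝ} (hc : 0 ≤ c) (hy : 0 ≤ y) :
    Real.log (1 + c * y) ≤ Real.log (1 + c) + Real.log (1 + y) := by
  rw [← Real.log_mul (by positivity) (by positivity)]
  exact Real.log_le_log (by positivity) (by nlinarith)

/-- In the right half-plane `|1 + z| ≥ 1`, so the real part of the logarithm is nonnegative; the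
imaginary part is an argument. -/
theorem Complex.norm_log_one_add_le_log_add_pi {z : ℂ} (hz : 0 ≤ z.re) :
    ‖Complex.log (1 + z)‖ ≤ Real.log (1 + ‖z‖) + Real.pi := by
  have h1 : 1 ≤ ‖1 + z‖ := by
    refine le_trans ?_ (Complex.re_le_norm _)
    simpa using hz
  refine (Complex.norm_le_abs_re_add_abs_im _).trans (add_le_add ?_ ?_)
  · rw [Complex.log_re, abs_of_nonneg (Real.log_nonneg h1)]
    refine Real.log_le_log (by linarith) ((norm_add_le _ _).trans (by simp))
  · rw [Complex.log_im]
    exact Complex.abs_arg_le_pi _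

/-- The identity of the line is a pointwise limit of simple functions that it dominates up to a
factor two. -/
theorem exists_simpleFunc_tendsto_id : ∃ h : ℕ → SimpleFunc ℝ ℝ,
    (∀ x, Tendsto (fun n => h n x) atTop (𝓝 x)) ∧ ∀ n x, |h n x| ≤ 2 * |x| := by
  refine ⟨SimpleFunc.approxOn id measurable_id univ 0 (mem_univ _), fun x => ?_, fun n x => ?_⟩
  · exact SimpleFunc.tendsto_approxOn measurable_id (mem_univ _) (by simp)
  · have := SimpleFunc.norm_approxOn_zero_le measurable_id (mem_univ (0 : ℝ)) x n
    simp only [Real.norm_eq_abs, id] at this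
    linarith

/-- One `α`-integrable majorant for both the simple approximations (`y = h n x`) and the limit (`y =
x`). -/
theorem norm_log_one_sub_mul_I_le {t x y : ℝ} (h : |y| ≤ 2 * |x|) :
    ‖Complex.log (1 - t * Complex.I * y)‖ ≤
      Real.log (1 + 2 * |t|) + Real.log (1 + |x|) + Real.pi := by
  rw [sub_eq_add_neg]
  refine (Complex.norm_log_one_add_le_log_add_pi (by simp)).trans ?_
  gcongr
  refine le_trans (Real.log_le_log (by positivity) ?_)
    (Real.log_one_add_mul_le (by positivity) (abs_nonneg x))
  simp only [norm_neg, norm_mul, Complex.norm_I, mul_one, Complex.norm_real, Real.norm_eq_abs]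
  nlinarith [abs_nonneg t]

theorem measurable_log_one_sub_mul_I (t : ℝ) :
    Measurable fun x : ℝ => Complex.log (1 - t * Complex.I * x) := by
  fun_prop

section
variable {α : Measure ℝ} [IsFiniteMeasure α]

theorem integrable_log_one_sub_mul_I (hlog : Integrable (fun x : ℝ => Real.log (1 + |x|)) α)
    (t : ℝ) : Integrable (fun x : ℝ => Complex.log (1 - t * Complex.I * x)) α := by
  refine Integrable.mono' (((integrable_const (Real.log (1 + 2 * |t|))).add hlog).add
    (integrable_const Real.pi)) (measurable_log_one_sub_mul_I t).aestronglyMeasurable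
    (Eventually.of_forall fun x => norm_log_one_sub_mul_I_le ?_)
  linarith [abs_nonneg x]

theorem tendsto_integral_log_simpleFunc
    (hlog : Integrable (fun x : ℝ => Real.log (1 + |x|)) α) {h : ℕ → SimpleFunc ℝ ℝ}
    (hlim : ∀ x, Tendsto (fun n => h n x) atTop (𝓝 x)) (hle : ∀ n x, |h n x| ≤ 2 * |x|) (t : ℝ) :
    Tendsto (fun n => ∫ x, Complex.log (1 - t * Complex.I * h n x) ∂α) atTop
      (𝓝 (∫ x, Complex.log (1 - t * Complex.I * x) ∂α)) := by
  refine tendsto_integral_of_dominated_convergence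
    (fun x => Real.log (1 + 2 * |t|) + Real.log (1 + |x|) + Real.pi)
    (fun n => ((measurable_log_one_sub_mul_I t).comp (h n).measurable).aestronglyMeasurable)
    (((integrable_const _).add hlog).add (integrable_const _))
    (fun n => Eventually.of_forall fun x => norm_log_one_sub_mul_I_le (hle n x))
    (Eventually.of_forall fun x => ?_)
  have hs : 1 - t * Complex.I * x ∈ Complex.slitPlane := Or.inl (by simp)
  refine (continuousAt_clog hs).tendsto.comp ?_
  exact ((Complex.continuous_ofReal.tendsto x).comp (hlim x)).const_mul _ |>.const_sub 1

theorem measurable_integral_simpleFunc (h : SimpleFunc ℝ ℝ) :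
    Measurable fun m : FiniteMeasure ℝ => ∫ x, h x ∂(m : Measure ℝ) := by
  have : ∀ m : FiniteMeasure ℝ, ∫ x, h x ∂(m : Measure ℝ) =
      ∑ y ∈ h.range, ((m : Measure ℝ) (h ⁻¹' {y})).toReal • y := fun m =>
    SimpleFunc.integral_eq_sum _ (SimpleFunc.integrable_of_isFiniteMeasure h)
  simp_rw [this]
  refine Finset.measurable_sum _ fun y _ => Measurable.smul_const ?_ y
  exact ((Measure.measurable_coe (h.measurableSet_fiber y)).comp measurable_subtype_coe).ennreal_toReal

theorem measurable_lintegral_finiteMeasure {f : ℝ → ENNReal} (hf : Measurable f) :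
    Measurable fun m : FiniteMeasure ℝ => ∫⁻ x, f x ∂(m : Measure ℝ) :=
  (Measure.measurable_lintegral hf).comp measurable_subtype_coe

variable {Q : Measure (FiniteMeasure ℝ)}

/-- The Laplace transform detects infinite values of a nonnegative integral, which the
characteristic function does not; hence this real case `z = -s`. -/
theorem IsFunctionalGamma.integral_exp_neg_simpleFunc (hQ : IsFunctionalGamma α Q)
    (h : SimpleFunc ℝ ℝ) (h0 : ∀ x, 0 ≤ h x) {s : ℝ} (hs : 0 ≤ s) :
    ∫ m : FiniteMeasure ℝ, Real.exp (-(s * ∫ x, h x ∂(m : Measure ℝ))) ∂Q =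
      Real.exp (-∫ x, Real.log (1 + s * h x) ∂α) := by
  have hre : ∀ x, ((-s : ℂ) * h x).re < 1 := by
    intro x
    have : 0 ≤ s * h x := mul_nonneg hs (h0 x)
    have h2 : ((-s : ℂ) * h x).re = -(s * h x) := by simp
    linarith
  have key := hQ.integral_cexp_simpleFunc h hre
  have e1 : ∀ m : FiniteMeasure ℝ,
      Complex.exp (-s * ((∫ x, h x ∂(m : Measure ℝ) : ℝ) : ℂ)) =
        ((Real.exp (-(s * ∫ x, h x ∂(m : Measure ℝ))) : ℝ) : ℂ) := by
    intro m
    push_cast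
    congr 1
    ring
  have e2 : ∀ x, Complex.log (1 - -s * h x) = ((Real.log (1 + s * h x) : ℝ) : ℂ) := by
    intro x
    rw [Complex.ofReal_log (by have := mul_nonneg hs (h0 x); linarith)]
    push_cast
    congr 1
    ring
  simp_rw [e1, e2, integral_complex_ofReal, ← Complex.ofReal_neg, ← Complex.ofReal_exp] at key
  exact_mod_cast key

theorem tendsto_integral_log_one_add_mul (hlog : Integrable (fun x : ℝ => Real.log (1 + |x|)) α) :
    Tendsto (fun n : ℕ => ∫ x, Real.log (1 + 1 / ((n : ℝ) + 1) * (2 * |x|)) ∂α) atTop (𝓝 0) := by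
  have h := tendsto_integral_of_dominated_convergence (μ := α)
    (F := fun (n : ℕ) x => Real.log (1 + 1 / ((n : ℝ) + 1) * (2 * |x|))) (f := fun _ => 0)
    (fun x => Real.log (1 + 2) + Real.log (1 + |x|))
    (fun n => (by fun_prop : Measurable _).aestronglyMeasurable)
    ((integrable_const _).add hlog)
    (fun n => Eventually.of_forall fun x => ?_) (Eventually.of_forall fun x => ?_)
  · simpa using h
  · have h1 : 1 / ((n : ℝ) + 1) ≤ 1 := by
      rw [div_le_one (by positivity)]
      linarith [(Nat.cast_nonneg n : (0 : ℝ) ≤ n)]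
    rw [Real.norm_of_nonneg (Real.log_nonneg (le_add_of_nonneg_right (by positivity)))]
    refine le_trans (Real.log_le_log (by positivity) ?_)
      (Real.log_one_add_mul_le zero_le_two (abs_nonneg x))
    have := mul_le_of_le_one_left (by positivity : 0 ≤ 2 * |x|) h1
    linarith
  · have h2 := ((tendsto_one_div_add_atTop_nhds_zero_nat (𝕜 := ℝ)).mul_const (2 * |x|)).const_add 1
    have h3 := (Real.continuousAt_log (x := 1 + 0 * (2 * |x|)) (by simp)).tendsto.comp h2
    simpa [Function.comp_def] using h3

/-- Under the functional gamma distribution the identity is almost surely integrable. -/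
theorem IsFunctionalGamma.ae_integrable_id (hQ : IsFunctionalGamma α Q)
    (hlog : Integrable (fun x : ℝ => Real.log (1 + |x|)) α) :
    ∀ᵐ m : FiniteMeasure ℝ ∂Q, Integrable (fun x : ℝ => x) (m : Measure ℝ) := by
  have := hQ.isProbabilityMeasure
  obtain ⟨h, hlim, hle⟩ := exists_simpleFunc_tendsto_id
  let N : Set (FiniteMeasure ℝ) := {m | ∫⁻ x, ‖x‖ₑ ∂(m : Measure ℝ) = ⊤}
  have hN : MeasurableSet N :=
    measurable_lintegral_finiteMeasure measurable_enorm (measurableSet_singleton _)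
  let k : ℕ → SimpleFunc ℝ ℝ := fun n => (h n).map abs
  have hk : ∀ n x, k n x = |h n x| := fun n x => rfl
  let X : ℕ → FiniteMeasure ℝ → ℝ := fun n m => ∫ x, k n x ∂(m : Measure ℝ)
  have hXm : ∀ n, Measurable (X n) := fun n => measurable_integral_simpleFunc _
  have hX0 : ∀ n m, 0 ≤ X n m := fun n m => integral_nonneg fun x => abs_nonneg _
  -- The approximations need not be monotone; Fatou's lemma replaces monotone convergence.
  have hXtop : ∀ m ∈ N, Tendsto (fun n => X n m) atTop atTop := by
    intro m hm
    have h1 : (⊤ : ENNReal) ≤ liminf (fun n => ∫⁻ x, ‖h n x‖ₑ ∂(m : Measure ℝ)) atTop := by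
      rw [← show ∫⁻ x, ‖x‖ₑ ∂(m : Measure ℝ) = ⊤ from hm]
      refine le_trans (le_of_eq (lintegral_congr fun x => ?_))
        (lintegral_liminf_le fun n => (h n).measurable.enorm)
      exact ((continuous_enorm.tendsto x).comp (hlim x)).liminf_eq.symm
    have h2 : Tendsto (fun n => ∫⁻ x, ‖h n x‖ₑ ∂(m : Measure ℝ)) atTop (𝓝 ⊤) :=
      tendsto_of_le_liminf_of_limsup_le h1 le_top
    have h3 : ∀ n, ∫⁻ x, ‖h n x‖ₑ ∂(m : Measure ℝ) = ENNReal.ofReal (X n m) := by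
      intro n
      rw [ofReal_integral_eq_lintegral_ofReal (SimpleFunc.integrable_of_isFiniteMeasure (k n))
        (Eventually.of_forall fun x => abs_nonneg _)]
      refine lintegral_congr fun x => ?_
      rw [hk, ← Real.norm_eq_abs, ofReal_norm]
    simp_rw [h3] at h2
    exact ENNReal.tendsto_ofReal_nhds_top.1 h2
  -- Split `E exp (-s X n)` over `N` and its complement: the first part tends to `0` with `n`, the
  -- second is at most `Q(Nᶜ)`. The lower bound is uniform in `n` and tends to `1` as `s = 1/(j+1) →
  -- 0`.
  have hbound : ∀ j : ℕ, Real.exp (-∫ x, Real.log (1 + 1 / ((j : ℝ) + 1) * (2 * |x|)) ∂α) ≤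
      Q.real Nᶜ := by
    intro j
    set s : ℝ := 1 / ((j : ℝ) + 1) with hs
    have hs0 : 0 < s := by positivity
    have hmeas : ∀ n, Measurable fun m => Real.exp (-(s * X n m)) := fun n => by
      have := hXm n
      fun_prop
    have hle1 : ∀ n m, Real.exp (-(s * X n m)) ≤ 1 := fun n m => by
      rw [Real.exp_le_one_iff]
      have := mul_nonneg hs0.le (hX0 n m)
      linarith
    have hint : ∀ n, Integrable (fun m => Real.exp (-(s * X n m))) Q := fun n => by
      refine (integrable_const (1 : ℝ)).mono' (hmeas n).aestronglyMeasurable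
        (Eventually.of_forall fun m => ?_)
      rw [Real.norm_of_nonneg (Real.exp_nonneg _)]
      exact hle1 n m
    have hlimN : Tendsto (fun n => ∫ m in N, Real.exp (-(s * X n m)) ∂Q) atTop (𝓝 0) := by
      have := tendsto_integral_of_dominated_convergence (μ := Q.restrict N)
        (F := fun n m => Real.exp (-(s * X n m))) (f := fun _ => 0) (fun _ => 1)
        (fun n => (hmeas n).aestronglyMeasurable) (integrable_const _)
        (fun n => Eventually.of_forall fun m => by
          rw [Real.norm_of_nonneg (Real.exp_nonneg _)]; exact hle1 n m)
        ((ae_restrict_iff' hN).2 (Eventually.of_forall fun m hm =>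
          Real.tendsto_exp_neg_atTop_nhds_zero.comp ((hXtop m hm).const_mul_atTop hs0)))
      simpa using this
    have hlim2 := hlimN.add_const (Q.real Nᶜ)
    rw [zero_add] at hlim2
    refine ge_of_tendsto' hlim2 fun n => ?_
    have hlogint : Integrable (fun x => Real.log (1 + s * (2 * |x|))) α := by
      refine ((integrable_const (Real.log (1 + s * 2))).add hlog).mono'
        (by fun_prop : Measurable _).aestronglyMeasurable (Eventually.of_forall fun x => ?_)
      rw [Real.norm_of_nonneg (Real.log_nonneg (le_add_of_nonneg_right (by positivity))),
        ← mul_assoc]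
      exact Real.log_one_add_mul_le (by positivity) (abs_nonneg x)
    calc Real.exp (-∫ x, Real.log (1 + s * (2 * |x|)) ∂α)
        ≤ Real.exp (-∫ x, Real.log (1 + s * k n x) ∂α) := by
          refine Real.exp_le_exp.2 (neg_le_neg (integral_mono_of_nonneg
            (Eventually.of_forall fun x => Real.log_nonneg ?_) hlogint
            (Eventually.of_forall fun x => Real.log_le_log ?_ ?_)))
          · have := mul_nonneg hs0.le (abs_nonneg (h n x))
            rw [hk]; linarith
          · have := mul_nonneg hs0.le (abs_nonneg (h n x))
            rw [hk]; linarith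
          · have := mul_le_mul_of_nonneg_left (hle n x) hs0.le
            rw [hk]; linarith
      _ = ∫ m, Real.exp (-(s * X n m)) ∂Q :=
          (hQ.integral_exp_neg_simpleFunc (k n) (fun x => abs_nonneg _) hs0.le).symm
      _ = ∫ m in N, Real.exp (-(s * X n m)) ∂Q + ∫ m in Nᶜ, Real.exp (-(s * X n m)) ∂Q :=
          (integral_add_compl hN (hint n)).symm
      _ ≤ ∫ m in N, Real.exp (-(s * X n m)) ∂Q + Q.real Nᶜ := by
          gcongr
          refine (integral_mono (hint n).restrict (integrable_const 1) (hle1 n)).trans ?_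
          simp
  have hone : 1 ≤ Q.real Nᶜ := by
    refine le_of_tendsto' (x := atTop) ?_ hbound
    have := (Real.continuous_exp.tendsto _).comp (tendsto_integral_log_one_add_mul hlog).neg
    simpa [Function.comp_def] using this
  have hN0 : Q N = 0 := by
    have := probReal_compl_eq_one_sub (μ := Q) hN
    have h0 := measureReal_nonneg (μ := Q) (s := N)
    exact (measureReal_eq_zero_iff).1 (by linarith)
  have hae : ∀ᵐ m ∂Q, m ∉ N := measure_eq_zero_iff_ae_notMem.1 hN0
  filter_upwards [hae] with m hm
  exact ⟨measurable_id.aestronglyMeasurable, lt_top_iff_ne_top.2 hm⟩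

theorem tendsto_integral_simpleFunc {h : ℕ → SimpleFunc ℝ ℝ}
    (hlim : ∀ x, Tendsto (fun n => h n x) atTop (𝓝 x)) (hle : ∀ n x, |h n x| ≤ 2 * |x|)
    {m : FiniteMeasure ℝ} (hm : Integrable (fun x : ℝ => x) (m : Measure ℝ)) :
    Tendsto (fun n => ∫ x, h n x ∂(m : Measure ℝ)) atTop (𝓝 (measureMean m)) :=
  tendsto_integral_of_dominated_convergence (fun x => 2 * |x|)
    (fun n => (h n).measurable.aestronglyMeasurable) (hm.abs.const_mul 2)
    (fun n => Eventually.of_forall (hle n)) (Eventually.of_forall hlim)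

theorem IsFunctionalGamma.aemeasurable_measureMean (hQ : IsFunctionalGamma α Q)
    (hlog : Integrable (fun x : ℝ => Real.log (1 + |x|)) α) : AEMeasurable measureMean Q := by
  obtain ⟨h, hlim, hle⟩ := exists_simpleFunc_tendsto_id
  refine aemeasurable_of_tendsto_metrizable_ae atTop
    (fun n => (measurable_integral_simpleFunc (h n)).aemeasurable) ?_
  filter_upwards [hQ.ae_integrable_id hlog] with m hm using tendsto_integral_simpleFunc hlim hle hm

/-- The characteristic function of the mean of a functional gamma measure. -/
theorem IsFunctionalGamma.charFun_map_measureMean (hQ : IsFunctionalGamma α Q)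
    (hlog : Integrable (fun x : ℝ => Real.log (1 + |x|)) α) (t : ℝ) :
    charFun (Q.map measureMean) t =
      Complex.exp (-∫ x : ℝ, Complex.log (1 - t * Complex.I * x) ∂α) := by
  have := hQ.isProbabilityMeasure
  obtain ⟨h, hlim, hle⟩ := exists_simpleFunc_tendsto_id
  have hc : Continuous fun y : ℝ => Complex.exp (t * Complex.I * y) := by fun_prop
  have h1 : charFun (Q.map measureMean) t =
      ∫ m, Complex.exp (t * Complex.I * measureMean m) ∂Q := by
    rw [charFun_apply_real, integral_map (hQ.aemeasurable_measureMean hlog)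
      (by fun_prop : Continuous fun x : ℝ => Complex.exp (t * x * Complex.I)).aestronglyMeasurable]
    simp_rw [mul_right_comm]
  have h2 := tendsto_integral_of_dominated_convergence (μ := Q)
    (F := fun n m => Complex.exp (t * Complex.I * ((∫ x, h n x ∂(m : Measure ℝ) : ℝ) : ℂ)))
    (f := fun m => Complex.exp (t * Complex.I * measureMean m)) (fun _ => 1)
    (fun n => (hc.measurable.comp (measurable_integral_simpleFunc (h n))).aestronglyMeasurable)
    (integrable_const _) (fun n => Eventually.of_forall fun m => by simp [Complex.norm_exp])
    (by
      filter_upwards [hQ.ae_integrable_id hlog] with m hm using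
        (hc.tendsto _).comp (tendsto_integral_simpleFunc hlim hle hm))
  rw [h1]
  refine tendsto_nhds_unique h2 ?_
  simp_rw [fun n => hQ.integral_cexp_simpleFunc (h n) (z := t * Complex.I) (by simp)]
  exact (Complex.continuous_exp.tendsto _).comp (tendsto_integral_log_simpleFunc hlog hlim hle t).neg

end

/-! ### Infinite divisibility -/

/-- A pointwise limit of characteristic functions which is continuous at zero is a characteristic
function. -/
theorem exists_charFun_eq_of_tendsto {μ : ℕ → ProbabilityMeasure ℝ} {f : ℝ → ℂ}
    (hf : ContinuousAt f 0)
    (h : ∀ t, Tendsto (fun n => charFun (μ n : Measure ℝ) t) atTop (𝓝 (f t))) :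
    ∃ ν : ProbabilityMeasure ℝ, ∀ t, charFun (ν : Measure ℝ) t = f t := by
  have htight := isTightMeasureSet_of_tendsto_charFun (μ := fun n => (μ n : Measure ℝ)) hf h
  have hcomp : IsCompact (closure (range μ)) := by
    refine isCompact_closure_of_isTightMeasureSet ?_
    convert htight using 1
    ext ρ
    simp
  -- By compactness the sequence converges along a free ultrafilter, which serves in place of a
  -- convergent subsequence.
  obtain ⟨ν, -, hν⟩ := hcomp.ultrafilter_le_nhds ((hyperfilter ℕ).map μ)
    (le_principal_iff.2 (mem_map.2 (univ_mem' fun n => subset_closure (mem_range_self n))))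
  have hν' : Tendsto μ (hyperfilter ℕ) (𝓝 ν) := hν
  refine ⟨ν, fun t => ?_⟩
  rw [ProbabilityMeasure.tendsto_iff_forall_integral_rclike_tendsto ℂ] at hν'
  have h1 := hν' (BoundedContinuousFunction.innerProbChar t)
  simp_rw [← charFun_eq_integral_innerProbChar] at h1
  refine tendsto_nhds_unique h1 ((h t).mono_left ?_)
  exact (hyperfilter_le_cofinite (α := ℕ)).trans Nat.cofinite_eq_atTop.le

section
variable {α : Measure ℝ} [IsFiniteMeasure α]

/-- Realized on a finite product of gamma laws, so that no random measure with parameter `α` is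
assumed to exist; this allows `α / n` later. -/
theorem exists_charFun_eq_exp_simpleFunc (h : SimpleFunc ℝ ℝ) :
    ∃ ν : ProbabilityMeasure ℝ, ∀ t : ℝ, charFun (ν : Measure ℝ) t =
      Complex.exp (-∫ x, Complex.log (1 - t * Complex.I * h x) ∂α) := by
  let b : h.range → ℝ := fun y => α.real (h ⁻¹' {(y : ℝ)})
  have hb : ∀ y, 0 ≤ b y := fun y => measureReal_nonneg
  have : ∀ y, IsProbabilityMeasure (gammaLaw (b y)) := fun y => isProbabilityMeasure_gammaLaw (hb y)
  let P : Measure (h.range → ℝ) := Measure.pi fun y => gammaLaw (b y)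
  let S : (h.range → ℝ) → ℝ := fun p => ∑ y : h.range, (y : ℝ) * p y
  have hS : Measurable S := by fun_prop
  have hlaw : ∀ y, HasLaw (fun p : h.range → ℝ => p y) (gammaLaw (b y)) P := fun y =>
    ⟨(measurable_pi_apply y).aemeasurable, (measurePreserving_eval _ y).map_eq⟩
  have hind : iIndepFun (fun y (p : h.range → ℝ) => p y) P :=
    iIndepFun_pi (X := fun _ x => x) fun _ => aemeasurable_id
  refine ⟨⟨P.map S, Measure.isProbabilityMeasure_map hS.aemeasurable⟩, fun t => ?_⟩
  rw [← sum_range_eq_integral_log, ← Finset.sum_coe_sort h.range]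
  refine Eq.trans ?_ (integral_cexp_sum_of_gammaLaw hb hlaw hind
    (c := fun y : h.range => (y : ℝ)) (z := t * Complex.I) (by simp))
  simp only [ProbabilityMeasure.coe_mk]
  rw [charFun_apply_real, integral_map hS.aemeasurable
    (by fun_prop : Continuous fun x : ℝ => Complex.exp (t * x * Complex.I)).aestronglyMeasurable]
  simp_rw [mul_right_comm]
  rfl

theorem continuousAt_exp_neg_integral_log
    (hlog : Integrable (fun x : ℝ => Real.log (1 + |x|)) α) :
    ContinuousAt (fun t : ℝ =>
      Complex.exp (-∫ x : ℝ, Complex.log (1 - t * Complex.I * x) ∂α)) 0 := by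
  refine Complex.continuous_exp.continuousAt.comp (ContinuousAt.neg ?_)
  refine continuousAt_of_dominated
    (bound := fun x => Real.log (1 + 2 * 1) + Real.log (1 + |x|) + Real.pi)
    (Eventually.of_forall fun t => (measurable_log_one_sub_mul_I t).aestronglyMeasurable) ?_
    (((integrable_const _).add hlog).add (integrable_const _))
    (Eventually.of_forall fun x => ?_)
  · filter_upwards [Metric.ball_mem_nhds (0 : ℝ) one_pos] with t ht
    have ht' : |t| ≤ 1 := by simpa using (mem_ball_zero_iff.1 ht).le
    refine Eventually.of_forall fun x => (norm_log_one_sub_mul_I_le (t := t) (x := x) (y := x)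
      (by linarith [abs_nonneg x])).trans ?_
    gcongr
  · refine ContinuousAt.clog (by fun_prop) (Or.inl (by simp))

/-- The exponent `-∫ log (1 - itx) α(dx)` belongs to a probability measure. -/
theorem exists_charFun_eq_exp_neg_integral_log
    (hlog : Integrable (fun x : ℝ => Real.log (1 + |x|)) α) :
    ∃ ν : ProbabilityMeasure ℝ, ∀ t : ℝ, charFun (ν : Measure ℝ) t =
      Complex.exp (-∫ x : ℝ, Complex.log (1 - t * Complex.I * x) ∂α) := by
  obtain ⟨h, hlim, hle⟩ := exists_simpleFunc_tendsto_id
  choose μ hμ using fun n => exists_charFun_eq_exp_simpleFunc (α := α) (h n)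
  refine exists_charFun_eq_of_tendsto (μ := μ) (continuousAt_exp_neg_integral_log hlog) fun t => ?_
  simp_rw [hμ]
  exact (Complex.continuous_exp.tendsto _).comp (tendsto_integral_log_simpleFunc hlog hlim hle t).neg

theorem isInfinitelyDivisibleCharFun_exp_neg_integral_log
    (hlog : Integrable (fun x : ℝ => Real.log (1 + |x|)) α) :
    IsInfinitelyDivisibleCharFun fun t : ℝ =>
      Complex.exp (-∫ x : ℝ, Complex.log (1 - t * Complex.I * x) ∂α) := by
  intro n hn
  have hn0 : (n : ℂ) ≠ 0 := by exact_mod_cast (by omega : n ≠ 0)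
  obtain ⟨ν, hν⟩ := exists_charFun_eq_exp_neg_integral_log (α := (n : NNReal)⁻¹ • α)
    hlog.smul_measure_nnreal
  refine ⟨ν, inferInstance, fun t => ?_⟩
  rw [hν, ← Complex.exp_nat_mul, integral_smul_nnreal_measure, NNReal.smul_def, Complex.real_smul]
  push_cast
  field_simp

end

/-! ### Frullani's integral in the right half-plane -/

/-- Writes the Frullani integrand as an integral over `s ∈ (0, 1]`; after Fubini the `v`-integral
leaves `z / (1 + sz)`, the `s`-derivative of `log (1 + sz)`. -/
theorem Complex.integral_mul_exp_neg_mul {z : ℂ} {v : ℝ} (hv : 0 < v) :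
    ∫ s in Ioc (0 : ℝ) 1, z * Complex.exp (-(s * z * v)) = (1 - Complex.exp (-(z * v))) / v := by
  rw [← intervalIntegral.integral_of_le zero_le_one]
  have hv' : (v : ℂ) ≠ 0 := by exact_mod_cast hv.ne'
  have hd : ∀ s ∈ uIcc (0 : ℝ) 1, HasDerivAt (fun s : ℝ => -Complex.exp (-(s * z * v)) / v)
      (z * Complex.exp (-(s * z * v))) s := by
    intro s _
    have h1 : HasDerivAt (fun s : ℝ => -((s : ℂ) * z * v)) (-(1 * z * v)) s :=
      ((Complex.ofRealCLM.hasDerivAt.mul_const z).mul_const (v : ℂ)).neg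
    convert! (h1.cexp.neg.div_const (v : ℂ)) using 1
    field_simp
  rw [intervalIntegral.integral_eq_sub_of_hasDerivAt hd
    ((by fun_prop : Continuous fun s : ℝ =>
      z * Complex.exp (-(s * z * v))).intervalIntegrable _ _)]
  simp
  ring

theorem Complex.integral_div_one_add_mul {z : ℂ} (hz : 0 ≤ z.re) :
    ∫ s in Ioc (0 : ℝ) 1, z / (1 + s * z) = Complex.log (1 + z) := by
  rw [← intervalIntegral.integral_of_le zero_le_one]
  have hs : ∀ s ∈ uIcc (0 : ℝ) 1, 1 + (s : ℂ) * z ∈ Complex.slitPlane := by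
    intro s hs
    rw [uIcc_of_le zero_le_one] at hs
    refine Or.inl ?_
    have := mul_nonneg hs.1 hz
    simp
    linarith
  have hd : ∀ s ∈ uIcc (0 : ℝ) 1, HasDerivAt (fun s : ℝ => Complex.log (1 + s * z))
      (z / (1 + s * z)) s := by
    intro s hs'
    have h1 : HasDerivAt (fun s : ℝ => 1 + (s : ℂ) * z) (1 * z) s :=
      (Complex.ofRealCLM.hasDerivAt.mul_const z).const_add 1
    simpa using h1.clog_real (hs s hs')
  rw [intervalIntegral.integral_eq_sub_of_hasDerivAt hd]
  · simp
  · refine ContinuousOn.intervalIntegrable fun s hs' => ContinuousAt.continuousWithinAt ?_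
    exact ContinuousAt.div (by fun_prop) (by fun_prop) (Complex.slitPlane_ne_zero (hs s hs'))

theorem Complex.integral_exp_neg_one_add_mul {w : ℂ} (hw : 0 ≤ w.re) :
    ∫ v in Ioi (0 : ℝ), Complex.exp (-(w * v)) * (Real.exp (-v) : ℝ) = 1 / (1 + w) := by
  have h := integral_exp_mul_complex_Ioi (a := -(1 + w)) (by simp; linarith) 0
  simp only [Complex.ofReal_zero, mul_zero, Complex.exp_zero, neg_div_neg_eq] at h
  rw [← h]
  refine integral_congr_ae (Eventually.of_forall fun v => ?_)
  simp only [Complex.ofReal_exp, ← Complex.exp_add]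
  congr 1
  push_cast
  ring

/-- For `re z ≥ 0` the exponential has modulus at most `1`, so `‖z‖ exp (-v)` dominates. -/
theorem Complex.integrable_frullani_kernel {z : ℂ} (hz : 0 ≤ z.re) :
    Integrable (fun p : ℝ × ℝ => z * Complex.exp (-(p.2 * z * p.1)) * (Real.exp (-p.1) : ℝ))
      ((volume.restrict (Ioi (0 : ℝ))).prod (volume.restrict (Ioc (0 : ℝ) 1))) := by
  have h1 : Integrable (fun v : ℝ => Real.exp (-v)) (volume.restrict (Ioi 0)) :=
    integrableOn_exp_neg_Ioi 0
  have h2 : Integrable (fun _ : ℝ => ‖z‖) (volume.restrict (Ioc (0 : ℝ) 1)) := by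
    exact integrable_const _
  refine (h1.mul_prod h2).mono'
    (by fun_prop : Measurable _).aestronglyMeasurable ?_
  rw [Measure.prod_restrict]
  refine (ae_restrict_iff' (measurableSet_Ioi.prod measurableSet_Ioc)).2
    (Eventually.of_forall fun p hp => ?_)
  have hv : 0 < p.1 := hp.1
  have hs : 0 < p.2 := hp.2.1
  rw [norm_mul, norm_mul, Complex.norm_real, Real.norm_of_nonneg (Real.exp_nonneg _),
    Complex.norm_exp, mul_comm]
  refine mul_le_mul_of_nonneg_left (mul_le_of_le_one_right (norm_nonneg _) ?_) (Real.exp_nonneg _)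
  rw [Real.exp_le_one_iff]
  have := mul_nonneg (mul_nonneg hs.le hz) hv.le
  simpa using this

theorem Complex.frullani_integrand {z : ℂ} {v : ℝ} (hv : 0 < v) :
    ∫ s in Ioc (0 : ℝ) 1, z * Complex.exp (-(s * z * v)) * (Real.exp (-v) : ℝ) =
      (v⁻¹ * Real.exp (-v)) • (1 - Complex.exp (-(z * v))) := by
  rw [integral_mul_const, Complex.integral_mul_exp_neg_mul hv, Complex.real_smul]
  push_cast
  ring

theorem Complex.integrableOn_frullani {z : ℂ} (hz : 0 ≤ z.re) :
    IntegrableOn (fun v : ℝ => (v⁻¹ * Real.exp (-v)) • (1 - Complex.exp (-(z * v))))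
      (Ioi 0) := by
  refine (Complex.integrable_frullani_kernel hz).integral_prod_left.congr ?_
  refine (ae_restrict_iff' measurableSet_Ioi).2 (Eventually.of_forall fun v hv => ?_)
  exact Complex.frullani_integrand hv

/-- Frullani's integral for the logarithm in the right half-plane. -/
theorem Complex.integral_frullani {z : ℂ} (hz : 0 ≤ z.re) :
    ∫ v in Ioi (0 : ℝ), (v⁻¹ * Real.exp (-v)) • (1 - Complex.exp (-(z * v))) =
      Complex.log (1 + z) := by
  rw [← setIntegral_congr_fun measurableSet_Ioi fun v hv => Complex.frullani_integrand (z := z) hv,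
    integral_integral_swap (Complex.integrable_frullani_kernel hz),
    ← Complex.integral_div_one_add_mul hz]
  refine setIntegral_congr_fun measurableSet_Ioc fun s hs => ?_
  have hw : 0 ≤ ((s : ℂ) * z).re := by
    have := mul_nonneg hs.1.le hz
    simpa
  simp only [mul_assoc z]
  rw [integral_const_mul, Complex.integral_exp_neg_one_add_mul hw]
  ring

theorem Real.frullani_integrand_eq (x v : ℝ) :
    (v⁻¹ * Real.exp (-v)) • (1 - Complex.exp (-((x : ℂ) * v))) =
      ((v⁻¹ * Real.exp (-v) * (1 - Real.exp (-(x * v))) : ℝ) : ℂ) := by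
  rw [Complex.real_smul]
  push_cast
  rfl

theorem Real.integrableOn_frullani {x : ℝ} (hx : 0 ≤ x) :
    IntegrableOn (fun v : ℝ => v⁻¹ * Real.exp (-v) * (1 - Real.exp (-(x * v)))) (Ioi 0) := by
  have h := Complex.integrableOn_frullani (z := x) (by simpa)
  simp_rw [Real.frullani_integrand_eq] at h
  exact h.re

theorem Real.integral_frullani {x : ℝ} (hx : 0 ≤ x) :
    ∫ v in Ioi (0 : ℝ), v⁻¹ * Real.exp (-v) * (1 - Real.exp (-(x * v))) = Real.log (1 + x) := by
  have h := Complex.integral_frullani (z := x) (by simpa)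
  simp_rw [Real.frullani_integrand_eq, integral_complex_ofReal] at h
  rw [← Complex.ofReal_inj, h, Complex.ofReal_log (by positivity)]
  push_cast
  rfl

/-! ### The Lévy density -/

/-- The Lévy density of `x • Γ`, where `Γ` is a gamma variable of unit shape. -/
noncomputable def gammaLevyKernel (x u : ℝ) : ℝ :=
  if 0 < x * u then |u|⁻¹ * Real.exp (-(x⁻¹ * u)) else 0

/-- The Lévy density of the mean of the functional gamma distribution with parameter `α`. -/
noncomputable def levyDensity (α : Measure ℝ) (u : ℝ) : ℝ := ∫ x, gammaLevyKernel x u ∂α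

theorem gammaLevyKernel_nonneg (x u : ℝ) : 0 ≤ gammaLevyKernel x u := by
  unfold gammaLevyKernel
  split_ifs <;> positivity

theorem measurable_gammaLevyKernel : Measurable fun p : ℝ × ℝ => gammaLevyKernel p.1 p.2 :=
  Measurable.ite (measurableSet_lt measurable_const (measurable_fst.mul measurable_snd))
    (by fun_prop) measurable_const

theorem gammaLevyKernel_zero_left (u : ℝ) : gammaLevyKernel 0 u = 0 := by simp [gammaLevyKernel]

theorem levyDensity_nonneg (α : Measure ℝ) (u : ℝ) : 0 ≤ levyDensity α u :=
  integral_nonneg fun x => gammaLevyKernel_nonneg x u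

/-- The substitution `u = xv` treats both signs of `x` at once, since `x * (x * v)` has the sign of
`v`. -/
theorem abs_mul_gammaLevyKernel_mul {x : ℝ} (hx : x ≠ 0) (v : ℝ) :
    |x| * gammaLevyKernel x (x * v) =
      (Ioi (0 : ℝ)).indicator (fun v => v⁻¹ * Real.exp (-v)) v := by
  have h : 0 < x * (x * v) ↔ 0 < v := by
    rw [← mul_assoc]
    exact mul_pos_iff_of_pos_left (mul_self_pos.2 hx)
  by_cases hv : 0 < v
  · have hx' : |x| ≠ 0 := abs_ne_zero.2 hx
    rw [gammaLevyKernel, if_pos (h.2 hv), indicator_of_mem (mem_Ioi.2 hv), abs_mul,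
      abs_of_pos hv, inv_mul_cancel_left₀ hx]
    field_simp
  · rw [gammaLevyKernel, if_neg (h.not.2 hv), indicator_of_notMem (by simpa using hv), mul_zero]

section
variable {E : Type*} [NormedAddCommGroup E] [NormedSpace ℝ E]

theorem abs_smul_gammaLevyKernel_smul {x : ℝ} (hx : x ≠ 0) (F : ℝ → E) (v : ℝ) :
    |x| • gammaLevyKernel x (x * v) • F (x * v) =
      (Ioi (0 : ℝ)).indicator (fun v => (v⁻¹ * Real.exp (-v)) • F (x * v)) v := by
  rw [smul_smul, abs_mul_gammaLevyKernel_mul hx]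
  by_cases hv : v ∈ Ioi (0 : ℝ) <;> simp [hv]

theorem integral_gammaLevyKernel_smul {x : ℝ} (hx : x ≠ 0) (F : ℝ → E) :
    ∫ u, gammaLevyKernel x u • F u = ∫ v in Ioi 0, (v⁻¹ * Real.exp (-v)) • F (x * v) := by
  rw [← integral_indicator measurableSet_Ioi]
  simp_rw [← abs_smul_gammaLevyKernel_smul hx F]
  rw [integral_smul, Measure.integral_comp_mul_left (fun u => gammaLevyKernel x u • F u) x,
    smul_smul, abs_inv, mul_inv_cancel₀ (abs_ne_zero.2 hx), one_smul]

theorem integrable_gammaLevyKernel_smul_iff {x : ℝ} (hx : x ≠ 0) (F : ℝ → E) :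
    Integrable (fun u => gammaLevyKernel x u • F u) ↔
      IntegrableOn (fun v => (v⁻¹ * Real.exp (-v)) • F (x * v)) (Ioi 0) := by
  rw [← integrable_indicator_iff measurableSet_Ioi,
    ← integrable_comp_mul_left_iff (fun u => gammaLevyKernel x u • F u) hx]
  have h : ((Ioi (0 : ℝ)).indicator fun v => (v⁻¹ * Real.exp (-v)) • F (x * v)) =
      fun v => |x| • gammaLevyKernel x (x * v) • F (x * v) :=
    funext fun v => (abs_smul_gammaLevyKernel_smul hx F v).symm
  rw [h]
  exact (integrable_smul_iff (abs_ne_zero.2 hx) _).symm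

end

theorem levyG_eq (α : Measure ℝ) (u : ℝ) : levyG α u = levyDensity α u * (u ^ 2 / (1 + u ^ 2)) := by
  have hmeas : ∀ u : ℝ, Measurable fun y : ℝ => Real.exp (-(y * u)) := fun u => by fun_prop
  -- Here `s` is the half-line of points with the sign of `u`, stable under inversion; the factor
  -- `|u|` offsets the `|u|⁻¹` of the kernel.
  have key : ∀ s : Set ℝ, MeasurableSet s → (∀ x : ℝ, x⁻¹ ∈ s ↔ x ∈ s) → (0 : ℝ) ∉ s →
      ∀ u : ℝ, (∀ x : ℝ, x ∈ s ↔ 0 < x * u) →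
      ∫ y in s, Real.exp (-(y * u)) ∂inverseMeasure α = |u| * levyDensity α u := by
    intro s hs hinv h0 u hsu
    have hu : |u| ≠ 0 ∨ s = ∅ := by
      rcases eq_or_ne u 0 with rfl | hu
      · exact Or.inr (eq_empty_of_forall_notMem fun x hx => by simpa using (hsu x).1 hx)
      · exact Or.inl (abs_ne_zero.2 hu)
    have hpre : (fun x : ℝ => x⁻¹) ⁻¹' s = s := Set.ext hinv
    rw [inverseMeasure, setIntegral_map hs (hmeas u).aestronglyMeasurable measurable_inv.aemeasurable,
      hpre, Measure.restrict_restrict hs, inter_eq_left.2 (fun x hx => by rintro rfl; exact h0 hx),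
      levyDensity, ← integral_const_mul, ← integral_indicator hs]
    refine integral_congr_ae (Eventually.of_forall fun x => ?_)
    by_cases hx : x ∈ s
    · have hu' : |u| ≠ 0 := hu.resolve_right (Set.nonempty_iff_ne_empty.1 ⟨x, hx⟩)
      simp [hx, gammaLevyKernel, (hsu x).1 hx, hu']
    · simp [hx, gammaLevyKernel, (hsu x).not.1 hx]
  unfold levyG
  rcases lt_trichotomy u 0 with hu | rfl | hu
  · rw [indicator_of_notMem (by simpa using hu), indicator_of_mem (mem_Iio.2 hu),
      key (Iio 0) measurableSet_Iio (fun x => by simp) (by simp) u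
        (fun x => ⟨fun hx => mul_pos_of_neg_of_neg hx hu, fun h => neg_of_mul_pos_left h hu.le⟩),
      ← sq_abs u]
    ring
  · simp
  · rw [indicator_of_mem (mem_Ici.2 hu.le), indicator_of_notMem (by simpa using hu.le),
      key (Ioi 0) measurableSet_Ioi (fun x => by simp) (by simp) u
        (fun x => ⟨fun hx => mul_pos hx hu, fun h => pos_of_mul_pos_left h hu.le⟩),
      ← sq_abs u]
    ring

theorem integrable_gammaLevyKernel_mul (x : ℝ) :
    Integrable fun u => gammaLevyKernel x u • (1 - Real.exp (-|u|)) := by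
  rcases eq_or_ne x 0 with rfl | hx
  · simp [gammaLevyKernel_zero_left]
  rw [integrable_gammaLevyKernel_smul_iff hx]
  refine (Real.integrableOn_frullani (abs_nonneg x)).congr_fun (fun v hv => ?_) measurableSet_Ioi
  simp [abs_mul, abs_of_pos (mem_Ioi.1 hv)]

/-- The weight `1 - exp (-|u|)` is chosen so that its integral against the kernel is exactly the
function in the log moment hypothesis. -/
theorem integral_gammaLevyKernel_mul (x : ℝ) :
    ∫ u, gammaLevyKernel x u • (1 - Real.exp (-|u|)) = Real.log (1 + |x|) := by
  rcases eq_or_ne x 0 with rfl | hx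
  · simp [gammaLevyKernel_zero_left]
  rw [integral_gammaLevyKernel_smul hx, ← Real.integral_frullani (abs_nonneg x)]
  refine setIntegral_congr_fun measurableSet_Ioi fun v hv => ?_
  simp [abs_mul, abs_of_pos (mem_Ioi.1 hv)]

theorem integral_gammaLevyKernel_cexp (t x : ℝ) :
    ∫ u : ℝ, gammaLevyKernel x u • (Complex.exp (Complex.I * t * u) - 1) =
      -Complex.log (1 - t * Complex.I * x) := by
  rcases eq_or_ne x 0 with rfl | hx
  · simp [gammaLevyKernel_zero_left]
  rw [integral_gammaLevyKernel_smul hx, sub_eq_add_neg,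
    ← Complex.integral_frullani (by simp), ← integral_neg]
  refine setIntegral_congr_fun measurableSet_Ioi fun v hv => ?_
  simp only [← smul_neg, neg_sub]
  congr 3
  push_cast
  ring

/-! ### Domination by `1 - exp (-|u|)` and Fubini -/

theorem abs_div_one_add_abs_le (u : ℝ) : |u| / (1 + |u|) ≤ 1 - Real.exp (-|u|) := by
  have h := Real.add_one_le_exp |u|
  have h0 := abs_nonneg u
  rw [Real.exp_neg, div_le_iff₀ (by positivity)]
  have h1 : (Real.exp |u|)⁻¹ * (1 + |u|) ≤ 1 := by
    rw [inv_mul_le_iff₀ (Real.exp_pos _)]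
    linarith
  linarith

theorem abs_sq_div_le (u : ℝ) : |u ^ 2 / (1 + u ^ 2)| ≤ 2 * (1 - Real.exp (-|u|)) := by
  refine le_trans ?_ (mul_le_mul_of_nonneg_left (abs_div_one_add_abs_le u) zero_le_two)
  rw [abs_of_nonneg (by positivity), ← mul_div_assoc, div_le_div_iff₀ (by positivity) (by positivity),
    ← sq_abs]
  have h0 := abs_nonneg u
  nlinarith [mul_nonneg h0 (sq_nonneg (|u| - 1)), mul_nonneg h0 h0]

theorem abs_div_one_add_sq_le (u : ℝ) : |u / (1 + u ^ 2)| ≤ 2 * (1 - Real.exp (-|u|)) := by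
  refine le_trans ?_ (mul_le_mul_of_nonneg_left (abs_div_one_add_abs_le u) zero_le_two)
  rw [abs_div, abs_of_nonneg (by positivity : 0 ≤ 1 + u ^ 2), ← mul_div_assoc,
    div_le_div_iff₀ (by positivity) (by positivity), ← sq_abs]
  have h0 := abs_nonneg u
  nlinarith [mul_nonneg h0 (sq_nonneg (|u| - 1)), mul_nonneg h0 h0, mul_nonneg (mul_nonneg h0 h0) h0]

theorem norm_cexp_sub_one_le (t u : ℝ) :
    ‖Complex.exp (Complex.I * t * u) - 1‖ ≤ (2 + |t|) * (1 - Real.exp (-|u|)) := by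
  refine le_trans ?_ (mul_le_mul_of_nonneg_left (abs_div_one_add_abs_le u) (by positivity))
  have h1 : ‖Complex.exp (Complex.I * t * u) - 1‖ ≤ |t| * |u| := by
    have := Real.norm_exp_I_mul_ofReal_sub_one_le (x := t * u)
    rw [Real.norm_eq_abs, abs_mul] at this
    convert this using 4
    push_cast
    ring
  have h2 : ‖Complex.exp (Complex.I * t * u) - 1‖ ≤ 2 := by
    refine (norm_sub_le _ _).trans ?_
    have : ‖Complex.exp (Complex.I * t * u)‖ = 1 := by simp [Complex.norm_exp]
    rw [this, norm_one]
    norm_num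
  have h0 := abs_nonneg u
  rw [← mul_div_assoc, le_div_iff₀ (by positivity)]
  -- In the product with `1 + |u|`, the bound `|t||u|` is used on the term `1` and the bound `2` on
  -- the term `|u|`.
  nlinarith [mul_le_mul_of_nonneg_right h2 h0]

section
variable {α : Measure ℝ}

theorem integrable_prod_gammaLevyKernel (hlog : Integrable (fun x : ℝ => Real.log (1 + |x|)) α) :
    Integrable (fun p : ℝ × ℝ => gammaLevyKernel p.1 p.2 • (1 - Real.exp (-|p.2|)))
      (α.prod volume) := by
  have hm : Measurable fun p : ℝ × ℝ => gammaLevyKernel p.1 p.2 • (1 - Real.exp (-|p.2|)) :=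
    measurable_gammaLevyKernel.smul (by fun_prop)
  rw [integrable_prod_iff hm.aestronglyMeasurable]
  refine ⟨Eventually.of_forall integrable_gammaLevyKernel_mul, hlog.congr ?_⟩
  refine Eventually.of_forall fun x => ?_
  simp only
  rw [← integral_gammaLevyKernel_mul]
  refine integral_congr_ae (Eventually.of_forall fun u => ?_)
  refine (Real.norm_of_nonneg (smul_nonneg (gammaLevyKernel_nonneg x u) ?_)).symm
  exact (by positivity : 0 ≤ |u| / (1 + |u|)).trans (abs_div_one_add_abs_le u)

section
variable {E : Type*} [NormedAddCommGroup E] [NormedSpace ℝ E]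
  {F : ℝ → E} {C : ℝ}

/-- A single criterion that serves `exp (itu) - 1`, `u² / (1 + u²)` and `u / (1 + u²)`. -/
theorem integrable_prod_gammaLevyKernel_smul
    (hlog : Integrable (fun x : ℝ => Real.log (1 + |x|)) α) (hF : StronglyMeasurable F)
    (hC : ∀ u, ‖F u‖ ≤ C * (1 - Real.exp (-|u|))) :
    Integrable (fun p : ℝ × ℝ => gammaLevyKernel p.1 p.2 • F p.2) (α.prod volume) := by
  refine ((integrable_prod_gammaLevyKernel hlog).const_mul C).mono'
    (measurable_gammaLevyKernel.stronglyMeasurable.smul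
      (hF.comp_measurable measurable_snd)).aestronglyMeasurable
    (Eventually.of_forall fun p => ?_)
  rw [norm_smul, Real.norm_of_nonneg (gammaLevyKernel_nonneg _ _), smul_eq_mul, mul_left_comm]
  exact mul_le_mul_of_nonneg_left (hC _) (gammaLevyKernel_nonneg _ _)

variable [SFinite α] [CompleteSpace E]

theorem integrable_levyDensity_smul
    (hlog : Integrable (fun x : ℝ => Real.log (1 + |x|)) α) (hF : StronglyMeasurable F)
    (hC : ∀ u, ‖F u‖ ≤ C * (1 - Real.exp (-|u|))) :
    Integrable fun u => levyDensity α u • F u := by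
  have h := (integrable_prod_gammaLevyKernel_smul hlog hF hC).integral_prod_right
  simp_rw [integral_smul_const] at h
  exact h

theorem integral_levyDensity_smul
    (hlog : Integrable (fun x : ℝ => Real.log (1 + |x|)) α) (hF : StronglyMeasurable F)
    (hC : ∀ u, ‖F u‖ ≤ C * (1 - Real.exp (-|u|))) :
    ∫ u, levyDensity α u • F u = ∫ x, ∫ u, gammaLevyKernel x u • F u ∂volume ∂α := by
  rw [integral_integral_swap (integrable_prod_gammaLevyKernel_smul hlog hF hC)]
  simp_rw [integral_smul_const]
  rfl

end

end

/-! ### The canonical pair and the degenerate case -/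

theorem levyG_nonneg (α : Measure ℝ) (u : ℝ) : 0 ≤ levyG α u := by
  rw [levyG_eq]
  exact mul_nonneg (levyDensity_nonneg α u) (by positivity)

theorem inv_mul_levyG (α : Measure ℝ) (u : ℝ) :
    u⁻¹ * levyG α u = levyDensity α u • (u / (1 + u ^ 2)) := by
  rw [levyG_eq, smul_eq_mul]
  rcases eq_or_ne u 0 with rfl | hu
  · simp
  · field_simp

section
variable {α : Measure ℝ} [IsFiniteMeasure α]

theorem integral_levyDensity_cexp (hlog : Integrable (fun x : ℝ => Real.log (1 + |x|)) α) (t : ℝ) :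
    ∫ u : ℝ, levyDensity α u • (Complex.exp (Complex.I * t * u) - 1) =
      -∫ x : ℝ, Complex.log (1 - t * Complex.I * x) ∂α := by
  rw [integral_levyDensity_smul hlog
    (by fun_prop : Continuous fun u : ℝ => Complex.exp (Complex.I * t * u) - 1).stronglyMeasurable
    (norm_cexp_sub_one_le t)]
  simp_rw [integral_gammaLevyKernel_cexp, integral_neg]

theorem integrable_levyDensity_cexp (hlog : Integrable (fun x : ℝ => Real.log (1 + |x|)) α)
    (t : ℝ) : Integrable fun u : ℝ => levyDensity α u • (Complex.exp (Complex.I * t * u) - 1) :=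
  integrable_levyDensity_smul hlog
    (by fun_prop : Continuous fun u : ℝ => Complex.exp (Complex.I * t * u) - 1).stronglyMeasurable
    (norm_cexp_sub_one_le t)

theorem integrable_levyG (hlog : Integrable (fun x : ℝ => Real.log (1 + |x|)) α) :
    Integrable (levyG α) := by
  have h := integrable_levyDensity_smul (F := fun u : ℝ => u ^ 2 / (1 + u ^ 2)) hlog
    (by fun_prop : Measurable fun u : ℝ => u ^ 2 / (1 + u ^ 2)).stronglyMeasurable abs_sq_div_le
  exact h.congr (Eventually.of_forall fun u => (levyG_eq α u).symm)

theorem integrable_inv_mul_levyG (hlog : Integrable (fun x : ℝ => Real.log (1 + |x|)) α) :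
    Integrable fun u => u⁻¹ * levyG α u := by
  simp_rw [inv_mul_levyG]
  exact integrable_levyDensity_smul hlog
    (by fun_prop : Measurable fun u : ℝ => u / (1 + u ^ 2)).stronglyMeasurable
    abs_div_one_add_sq_le

/-- The integral of the Lévy–Khintchine kernel against the canonical measure. -/
theorem setIntegral_levyKhintchine_eq (hlog : Integrable (fun x : ℝ => Real.log (1 + |x|)) α)
    (t : ℝ) :
    ∫ u : ℝ in {0}ᶜ, (Complex.exp (Complex.I * t * u) - 1 - Complex.I * t * u / (1 + u ^ 2)) *
        ((1 + u ^ 2) / u ^ 2) ∂volume.withDensity (fun x => ENNReal.ofReal (levyG α x)) =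
      -(∫ x : ℝ, Complex.log (1 - t * Complex.I * x) ∂α) -
        Complex.I * t * ∫ u : ℝ in {0}ᶜ, u⁻¹ * levyG α u := by
  have hae : AEMeasurable (fun x => ENNReal.ofReal (levyG α x)) (volume.restrict {0}ᶜ) :=
    (integrable_levyG hlog).aestronglyMeasurable.aemeasurable.ennreal_ofReal.restrict
  have hint : Integrable (fun u => Complex.I * t * ((u⁻¹ * levyG α u : ℝ) : ℂ)) :=
    (integrable_inv_mul_levyG hlog).ofReal.const_mul _
  rw [setIntegral_withDensity_eq_setIntegral_toReal_smul₀ hae (by simp) _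
    (measurableSet_singleton 0).compl, ← integral_levyDensity_cexp hlog, restrict_compl_singleton,
    ← integral_complex_ofReal, ← integral_const_mul,
    ← integral_sub (integrable_levyDensity_cexp hlog t) hint]
  -- Off the null point `0`, the factor `(1 + u²) / u²` cancels that of `levyG_eq`, and the
  -- centering term becomes `it` times `u⁻¹ * levyG α u`.
  refine integral_congr_ae ?_
  filter_upwards [compl_mem_ae_iff.2 (measure_singleton (0 : ℝ))] with u hu
  have hu' : (u : ℂ) ≠ 0 := by exact_mod_cast hu
  have h1 : (1 + (u : ℂ) ^ 2) ≠ 0 := by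
    exact_mod_cast (by positivity : (1 + u ^ 2) ≠ 0)
  rw [ENNReal.toReal_ofReal (levyG_nonneg α u), inv_mul_levyG, levyG_eq, Complex.real_smul,
    Complex.real_smul, smul_eq_mul]
  push_cast
  field_simp
end

/-- The distribution function of the measure with integrable density `g`. -/
theorem exists_stieltjesFunction_of_integrable {g : ℝ → ℝ} (h0 : ∀ x, 0 ≤ g x)
    (hg : Integrable g) : ∃ G : StieltjesFunction ℝ, (∀ x, G x = ∫ u in Iic x, g u) ∧
      G.measure = volume.withDensity (fun x => ENNReal.ofReal (g x)) ∧
      Tendsto G atBot (𝓝 0) ∧ Tendsto G atTop (𝓝 (∫ u, g u)) := by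
  have hcont : Continuous fun x => ∫ u in Iic x, g u := by
    have : (fun x => ∫ u in Iic x, g u) =
        fun x => (∫ u in Iic 0, g u) + ∫ u in (0 : ℝ)..x, g u := by
      ext x
      rw [← intervalIntegral.integral_Iic_sub_Iic hg.integrableOn hg.integrableOn]
      ring
    rw [this]
    exact continuous_const.add (intervalIntegral.continuous_primitive
      (fun a b => hg.intervalIntegrable) 0)
  let G : StieltjesFunction ℝ :=
    { toFun := fun x => ∫ u in Iic x, g u
      mono' := fun x y hxy => setIntegral_mono_set hg.integrableOn
        (Eventually.of_forall h0) (LE.le.eventuallyLE (Iic_subset_Iic.2 hxy))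
      right_continuous' := fun x => hcont.continuousWithinAt }
  have hG : ∀ x, G x = ∫ u in Iic x, g u := fun x => rfl
  have hbot : Tendsto G atBot (𝓝 0) := by
    exact tendsto_integral_Iic_zero tendsto_id
  have htop : Tendsto G atTop (𝓝 (∫ u, g u)) := by
    exact (aecover_Iic tendsto_id).integral_tendsto_of_countably_generated hg
  refine ⟨G, hG, ?_, hbot, htop⟩
  have hfin : IsFiniteMeasure (volume.withDensity fun x => ENNReal.ofReal (g x)) :=
    isFiniteMeasure_withDensity_ofReal hg.2
  have : IsFiniteMeasure G.measure := G.isFiniteMeasure hbot htop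
  refine Measure.ext_of_Iic _ _ fun x => ?_
  rw [G.measure_Iic hbot, withDensity_apply _ measurableSet_Iic, sub_zero, hG,
    ofReal_integral_eq_lintegral_ofReal hg.integrableOn (Eventually.of_forall h0)]

theorem isLevyKhintchinePair_of_forall_eq {α : Measure ℝ} [IsFiniteMeasure α]
    (hlog : Integrable (fun x : ℝ => Real.log (1 + |x|)) α) {φ : ℝ → ℂ}
    (hφ : ∀ t : ℝ, φ t = Complex.exp (-∫ x : ℝ, Complex.log (1 - t * Complex.I * x) ∂α))
    {G : StieltjesFunction ℝ}
    (hG : G.measure = volume.withDensity (fun x => ENNReal.ofReal (levyG α x)))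
    (hbot : Tendsto G atBot (𝓝 0)) (htop : Tendsto G atTop (𝓝 (∫ u, levyG α u))) :
    IsLevyKhintchinePair φ (∫ x in ({0}ᶜ : Set ℝ), x⁻¹ * levyG α x) G where
  tendsto_atBot := hbot
  tendsto_atTop := ⟨_, htop⟩
  representation t := by
    rw [hφ, hG, setIntegral_levyKhintchine_eq hlog]
    congr 1
    ring

/-- The exponent `-∫ log (1 - itx) α(dx)` vanishes identically only for measures concentrated at
zero. -/
theorem forall_exp_neg_integral_log_eq_one_iff {α : Measure ℝ} [IsFiniteMeasure α]
    (hlog : Integrable (fun x : ℝ => Real.log (1 + |x|)) α) :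
    (∀ t : ℝ, Complex.exp (-∫ x : ℝ, Complex.log (1 - t * Complex.I * x) ∂α) = 1) ↔
      α = α univ • Measure.dirac 0 := by
  constructor
  · intro h
    -- The single value `t = 1` suffices: `log |1 - ix|` is nonnegative with zero integral, and
    -- vanishes only at `x = 0`.
    have h1 := congrArg norm (h 1)
    have hint := integrable_log_one_sub_mul_I hlog 1
    rw [Complex.norm_exp, norm_one, Real.exp_eq_one_iff, Complex.neg_re, neg_eq_zero] at h1
    have hre : Integrable (fun x : ℝ => (Complex.log (1 - (1 : ℝ) * Complex.I * x)).re) α := hint.re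
    have h2 : ∫ x : ℝ, (Complex.log (1 - (1 : ℝ) * Complex.I * x)).re ∂α = 0 := by
      rw [← h1]
      exact integral_re hint
    have hnorm : ∀ x : ℝ, (1 : ℝ) ≤ ‖1 - (1 : ℝ) * Complex.I * x‖ := fun x =>
      le_trans (by simp) (Complex.re_le_norm _)
    rw [integral_eq_zero_iff_of_nonneg
      (fun x => by rw [Complex.log_re]; exact Real.log_nonneg (hnorm x)) hre] at h2
    have h3 : α {0}ᶜ = 0 := by
      refine measure_mono_null (fun x hx => ?_) (ae_iff.1 h2)
      intro h4
      simp only [Pi.zero_apply, Complex.log_re] at h4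
      have h5 : ‖1 - (1 : ℝ) * Complex.I * x‖ = 1 := by
        rcases Real.log_eq_zero.1 h4 with h | h | h <;> linarith [hnorm x]
      have h6 := Complex.sq_norm (1 - (1 : ℝ) * Complex.I * x)
      rw [h5, Complex.normSq_apply] at h6
      simp at h6
      exact hx h6
    refine Measure.ext fun s hs => ?_
    rw [Measure.smul_apply, Measure.dirac_apply' _ hs, smul_eq_mul]
    by_cases h0 : (0 : ℝ) ∈ s
    · rw [indicator_of_mem h0, Pi.one_apply, mul_one]
      refine le_antisymm (measure_mono (subset_univ s)) ?_
      refine (measure_mono (t := s ∪ {0}ᶜ) fun x _ => ?_).trans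
        ((measure_union_le _ _).trans (by rw [h3, add_zero]))
      by_cases hx : x = 0
      · exact Or.inl (hx ▸ h0)
      · exact Or.inr hx
    · rw [indicator_of_notMem h0, mul_zero]
      exact measure_mono_null (fun x hx => by rintro rfl; exact h0 hx) h3
  · intro h t
    rw [h, integral_smul_measure, integral_dirac]
    simp

theorem theorem3 (α : Measure ℝ) [IsFiniteMeasure α] (hα : α ≠ 0)
    (hlog : Integrable (fun x : ℝ => Real.log (1 + |x|)) α)
    (Q : Measure (FiniteMeasure ℝ)) (hQ : IsFunctionalGamma α Q) :
    -- the mean is a well-defined random variable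
    ((∀ᵐ (m : FiniteMeasure ℝ) ∂Q, Integrable (fun x : ℝ => x) (m : Measure ℝ)) ∧ AEMeasurable measureMean Q) ∧
    -- its characteristic function is infinitely divisible
    IsInfinitelyDivisibleCharFun (charFun (Q.map measureMean)) ∧
    -- the Lévy–Khintchine pair
    ((∀ x, 0 ≤ levyG α x) ∧ Integrable (levyG α) ∧
      IntegrableOn (fun x : ℝ => x⁻¹ * levyG α x) {0}ᶜ ∧
      ∃ G : StieltjesFunction ℝ, (∀ x, G x = ∫ u in Iic x, levyG α u) ∧
        G.measure = volume.withDensity (fun x => ENNReal.ofReal (levyG α x)) ∧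
        IsLevyKhintchinePair (charFun (Q.map measureMean))
          (∫ x in ({0}ᶜ : Set ℝ), x⁻¹ * levyG α x) G) ∧
    -- the degenerate case
    ((∀ t : ℝ, charFun (Q.map measureMean) t = 1) ↔ α = α univ • Measure.dirac 0) := by
  have hφ := hQ.charFun_map_measureMean hlog
  obtain ⟨G, hG, hGm, hbot, htop⟩ :=
    exists_stieltjesFunction_of_integrable (levyG_nonneg α) (integrable_levyG hlog)
  refine ⟨⟨hQ.ae_integrable_id hlog, hQ.aemeasurable_measureMean hlog⟩, ?_,
    ⟨levyG_nonneg α, integrable_levyG hlog, (integrable_inv_mul_levyG hlog).integrableOn,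
      G, hG, hGm, isLevyKhintchinePair_of_forall_eq hlog hφ hGm hbot htop⟩, ?_⟩
  · rw [funext hφ]
    exact isInfinitelyDivisibleCharFun_exp_neg_integral_log hlog
  · simp_rw [hφ]
    exact forall_exp_neg_integral_log_eq_one_iff hlog
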